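/- **Setting.** Let $\mathcal F$ be the fermionic Fock space with basis the semi-infinite wedges $e_{l_1}\wedge e_{l_2}\wedge\cdots$, where $l_1>l_2>\cdots$ are integers and $\{l_1,l_2,\dots\}$ differs from $\{-1,-2,\dots\}$ in finitely many elements. Let $|0\rangle=e_{-1}\wedge e_{-2}\wedge\cdots$, let $\langle 0|$ be the corresponding element of the dual basis, and let $\psi_j=e_j\wedge$ and $\psi_j^\dagger=i_{e^j}$ ($j\in\mathbf Z$) be the creation and annihilation operators. The neutral fermions are $$\phi^+_j=\tfrac1{\sqrt2}\big(\psi_j+(-1)^j\psi^\dagger_{-j}\big),\qquad \phi^-_j=\tfrac{i}{\sqrt2}\big(\psi_j-(-1)^j\psi^\dagger_{-j}\big).$$ Fix one of the two signs $\pm$. Let $A=(A_{jk})_{j,k\in\mathbf Z}$ be a skew-symmetric complex matrix with $A_{jk}=0$ whenever $j+k\ge 0$. (Under this condition $\hat h^\pm(A)$ below stabilizes the vacuum, and all the infinite sums of operators below are finite on each vector of $\mathcal F$.) Put $$\hat h^\pm(A)=e^{\hat A^\pm},\qquad \hat A^\pm=\tfrac12\sum_{j,k\in\mathbf Z}A_{jk}\,{:}\phi^\pm_j\phi^\pm_k{:}\,,\qquad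 {:}\phi^\pm_j\phi^\pm_k{:}=\phi^\pm_j\phi^\pm_k-\langle0|\phi^\pm_j\phi^\pm_k|0\rangle,$$ $$\hat\gamma^{B\pm}(\mathbf t_B)=\exp\Big(\sum_{j\ge1}t_{2j-1}J^{B\pm}_{2j-1}\Big),\qquad J^{B\pm}_j=\tfrac12\sum_{k\in\mathbf Z}(-1)^{k+1}\phi^\pm_k\phi^\pm_{-k-j},\qquad \mathbf t_B=(t_1,t_3,t_5,\dots).$$ For integers $\alpha_1>\cdots>\alpha_r\ge0$ (a strict partition, in which a last part $0$ is allowed) define $$Q_\alpha(\mathbf t_B|A)=2^{-r/2}\,\langle0|\,\hat\gamma^{B\pm}(2\mathbf t_B)\,\hat h^\pm(A)\,\phi^\pm_{\alpha_1}\cdots\phi^\pm_{\alpha_r}|0\rangle .$$ For $\mathbf x=(x_1,\dots,x_n)\in\mathbf C^n$ let $[\mathbf x]_B=([\mathbf x]_1,[\mathbf x]_3,[\mathbf x]_5,\dots)$ with $[\mathbf x]_j=\frac1j\sum_{a=1}^n x_a^j$. **Proposition 4.2** (analog of Schur's Pfaffian formula). For every such $A$, every strict partition $\alpha=(\alpha_1,\dots,\alpha_{2m})$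 with $\alpha_1>\cdots>\alpha_{2m}\ge 0$, and every $\mathbf x\in\mathbf C^n$, $$Q_\alpha([\mathbf x]_B|A)=\mathrm{Pf}\big(Q_{ij}([\mathbf x]_B|A)\big)_{1\le i,j\le 2m},$$ where $(Q_{ij}([\mathbf x]_B|A))$ is the skew-symmetric $2m\times2m$ matrix with $$Q_{ij}([\mathbf x]_B|A)=\begin{cases}Q_{(\alpha_i,\alpha_j)}([\mathbf x]_B|A) & i<j,\\ 0 & i=j,\\ -Q_{(\alpha_j,\alpha_i)}([\mathbf x]_B|A) & i>j,\end{cases}$$ and $\mathrm{Pf}(M)=\frac1{2^m m!}\sum_{\sigma\in S_{2m}}\mathrm{sgn}(\sigma)\prod_{i=1}^m M_{\sigma(2i-1),\sigma(2i)}$. -/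

import Mathlib

open scoped BigOperators

noncomputable section

namespace BKP

/-! ## The charged fermionic Fock space -/

/-- A set of integers (occupied sites) which agrees with the filled Dirac sea
`{-1, -2, ...}` up to finitely many particles `j ≥ 0` and finitely many holes `j < 0`. -/
structure Maya where
  carrier : Set ℤ
  finite_particles : {j : ℤ | 0 ≤ j ∧ j ∈ carrier}.Finite
  finite_holes : {j : ℤ | j < 0 ∧ j ∉ carrier}.Finite

namespace Maya

/-- The Dirac sea `{-1, -2, ...}`. -/
def vac : Maya where
  carrier := {j | j < 0}
  finite_particles := by
    have : {j : ℤ | 0 ≤ j ∧ j ∈ {j : ℤ | j < 0}} = ∅ := by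
      ext j; simp
    rw [this]; exact Set.finite_empty
  finite_holes := by
    have : {j : ℤ | j < 0 ∧ j ∉ {j : ℤ | j < 0}} = ∅ := by
      ext j; simp
    rw [this]; exact Set.finite_empty

/-- Occupy the site `j`. -/
def add (j : ℤ) (S : Maya) : Maya where
  carrier := insert j S.carrier
  finite_particles := by
    refine (S.finite_particles.insert j).subset ?_
    rintro k ⟨hk, hk'⟩
    rcases hk' with rfl | hk'
    · exact Set.mem_insert _ _
    · exact Set.mem_insert_of_mem _ ⟨hk, hk'⟩
  finite_holes := by
    refine S.finite_holes.subset ?_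
    rintro k ⟨hk, hk'⟩
    exact ⟨hk, fun h => hk' (Set.mem_insert_of_mem _ h)⟩

/-- Empty the site `j`. -/
def del (j : ℤ) (S : Maya) : Maya where
  carrier := S.carrier \ {j}
  finite_particles := by
    refine S.finite_particles.subset ?_
    rintro k ⟨hk, hk'⟩
    exact ⟨hk, hk'.1⟩
  finite_holes := by
    refine (S.finite_holes.insert j).subset ?_
    rintro k ⟨hk, hk'⟩
    by_cases h : k = j
    · exact h ▸ Set.mem_insert _ _
    · exact Set.mem_insert_of_mem _ ⟨hk, fun hS => hk' ⟨hS, h⟩⟩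

/-- The sign `(-1)^(number of occupied sites to the right of j)` met when `e_j` is moved to or from
the front of the semi-infinite wedge `e_{l_1} ∧ e_{l_2} ∧ ⋯`, `l_1 > l_2 > ⋯`, whose factors are
indexed by `S`. -/
def sign (j : ℤ) (S : Maya) : ℂ := (-1) ^ {k : ℤ | j < k ∧ k ∈ S.carrier}.ncard

end Maya

/-- The fermionic Fock space (sum of all charge sectors): the free vector space on the
semi-infinite wedges `e_{l_1} ∧ e_{l_2} ∧ ⋯`, `l_1 > l_2 > ⋯`, indexed by the set
`{l_1, l_2, ...}`. -/
abbrev Fock : Type := Maya →₀ ℂ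

/-- The basis vector of the Fock space indexed by `S`. -/
def ket (S : Maya) : Fock := Finsupp.single S 1

/-- The vacuum `|0⟩ = e_{-1} ∧ e_{-2} ∧ ⋯`. -/
def vacuum : Fock := ket Maya.vac

/-- The vacuum expectation value `⟨0| X |0⟩`, where `⟨0|` is the element dual to `|0⟩` of the
basis dual to the basis of semi-infinite wedges. -/
def vev (X : Module.End ℂ Fock) : ℂ := (X vacuum) Maya.vac

open Classical in
/-- The creation operator `ψ_j = e_j ∧`. -/
def psi (j : ℤ) : Module.End ℂ Fock :=
  Finsupp.linearCombination ℂ fun S : Maya =>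
    if j ∈ S.carrier then 0 else Maya.sign j S • ket (S.add j)

open Classical in
/-- The annihilation operator `ψ†_j`, the inner product with the dual basis vector `e^j`. -/
def psiDag (j : ℤ) : Module.End ℂ Fock :=
  Finsupp.linearCombination ℂ fun S : Maya =>
    if j ∈ S.carrier then Maya.sign j S • ket (S.del j) else 0

/-! ## Neutral fermions -/

/-- The two species of neutral fermions. -/
inductive Species
  | plus
  | minus

/-- The neutral fermions `φ^+_j = (ψ_j + (-1)^j ψ†_{-j}) / √2` and
`φ^-_j = i (ψ_j - (-1)^j ψ†_{-j}) / √2`. -/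
def phi : Species → ℤ → Module.End ℂ Fock
  | .plus, j => (1 / (Real.sqrt 2 : ℂ)) • (psi j + ((-1 : ℂ) ^ j) • psiDag (-j))
  | .minus, j => (Complex.I / (Real.sqrt 2 : ℂ)) • (psi j - ((-1 : ℂ) ^ j) • psiDag (-j))

/-- Normal ordering `:X Y: = X Y - ⟨0| X Y |0⟩` of a product of two linear elements. -/
def normalOrder (X Y : Module.End ℂ Fock) : Module.End ℂ Fock :=
  X * Y - vev (X * Y) • (1 : Module.End ℂ Fock)

/-! ## Infinite sums and exponentials of operators -/

/-- The sum of a locally finite family of operators (each vector is killed by all but finitely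
many members), computed on basis vectors, where it is a finite sum, and extended linearly. -/
def opSum {ι : Type*} (T : ι → Module.End ℂ Fock) : Module.End ℂ Fock :=
  Finsupp.linearCombination ℂ fun S : Maya => ∑ᶠ i, T i (ket S)

/-- For a locally finite family, `opSum` is the pointwise sum, on every vector. -/
theorem opSum_apply {ι : Type*} (T : ι → Module.End ℂ Fock)
    (hT : ∀ v : Fock, {i | T i v ≠ 0}.Finite) (v : Fock) : opSum T v = ∑ᶠ i, T i v := by
  induction v using Finsupp.induction_linear with
  | zero => simp
  | add f g hf hg =>
    rw [map_add, hf, hg, ← finsum_add_distrib (hT f) (hT g)]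
    simp
  | single S c =>
    have h : (Finsupp.single S c : Fock) = c • ket S := by simp [ket]
    rw [h, map_smul]
    simp only [map_smul]
    rw [← smul_finsum' c (hT (ket S))]
    simp [opSum, ket]

/-- The exponential `e^X = ∑_n X^n / n!` of a locally nilpotent operator. -/
def opExp (X : Module.End ℂ Fock) : Module.End ℂ Fock :=
  opSum fun n : ℕ => ((n.factorial : ℂ)⁻¹) • X ^ n

/-! ## The BKP tau functions and the generalized Schur `Q`-functions -/

/-- `Â = (1/2) ∑_{j,k} A_{jk} :φ_j φ_k:`. -/
def hatA (s : Species) (A : Matrix ℤ ℤ ℂ) : Module.End ℂ Fock :=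
  (1 / 2 : ℂ) • opSum fun p : ℤ × ℤ => A p.1 p.2 • normalOrder (phi s p.1) (phi s p.2)

/-- The fermionic representation `ĥ(A) = e^Â` of the orthogonal group element `h(A)`. -/
def hatH (s : Species) (A : Matrix ℤ ℤ ℂ) : Module.End ℂ Fock := opExp (hatA s A)

/-- The neutral current components `J^B_j = (1/2) ∑_k (-1)^(k+1) φ_k φ_{-k-j}`. -/
def currentB (s : Species) (j : ℕ) : Module.End ℂ Fock :=
  (1 / 2 : ℂ) • opSum fun k : ℤ => ((-1 : ℂ) ^ (k + 1)) • (phi s k * phi s (-k - (j : ℤ)))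

/-- The BKP flow `γ^B(t_B) = exp (∑_{j ≥ 1} t_{2j-1} J^B_{2j-1})`. Here and below the BKP flow
variables `t_B = (t_1, t_3, t_5, ...)` are the sequence `t` with `t i = t_{2i+1}`, `i ≥ 0`. -/
def gammaB (s : Species) (t : ℕ → ℂ) : Module.End ℂ Fock :=
  opExp (opSum fun i : ℕ => t i • currentB s (2 * i + 1))

/-- The state `|α) = φ_{α_1} ⋯ φ_{α_r} |0⟩`. -/
def state (s : Species) {r : ℕ} (α : Fin r → ℕ) : Fock :=
  (List.ofFn fun i => phi s (α i)).prod vacuum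

/-- The BKP tau function `κ_α(h(A))(t_B) = ⟨0| γ^B(t_B) ĥ(A) |α)`. -/
def kappa (s : Species) (A : Matrix ℤ ℤ ℂ) {r : ℕ} (α : Fin r → ℕ) (t : ℕ → ℂ) : ℂ :=
  (gammaB s t (hatH s A (state s α))) Maya.vac

/-- The generalized Schur `Q`-function `Q_α(t_B | A) = 2^(-r/2) κ_α(h(A))(2 t_B)`, `r` being the
number of parts of `α`. -/
def schurQ (s : Species) (A : Matrix ℤ ℤ ℂ) {r : ℕ} (α : Fin r → ℕ) (t : ℕ → ℂ) : ℂ :=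
  (((2 : ℝ) ^ (-((r : ℝ) / 2)) : ℝ) : ℂ) * kappa s A α fun i => 2 * t i

/-- The odd normalized power sums `[x]_B = ([x]_1, [x]_3, ...)`, `[x]_j = (1/j) ∑_a x_a^j`. -/
def powerSumB {n : ℕ} (x : Fin n → ℂ) (i : ℕ) : ℂ :=
  (1 / ((2 * i + 1 : ℕ) : ℂ)) * ∑ a, x a ^ (2 * i + 1)

/-- The skew-symmetric matrix with entries `Q_{(α_i, α_j)}([x]_B | A)` for `i < j`. -/
def twoPartMatrix (s : Species) (A : Matrix ℤ ℤ ℂ) {r : ℕ} (α : Fin r → ℕ) (t : ℕ → ℂ) :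
    Matrix (Fin r) (Fin r) ℂ :=
  Matrix.of fun i j =>
    if i < j then schurQ s A ![α i, α j] t
    else if j < i then -schurQ s A ![α j, α i] t
    else 0

/-- The Pfaffian
`Pf M = 1 / (2^m m!) ∑_{σ ∈ S_{2m}} sgn σ ∏_{i = 1}^m M_{σ(2i-1), σ(2i)}`
of a skew-symmetric `2m × 2m` matrix. -/
def pfaffian {m : ℕ} (M : Matrix (Fin (2 * m)) (Fin (2 * m)) ℂ) : ℂ :=
  (1 / ((2 : ℂ) ^ m * (m.factorial : ℂ))) *
    ∑ σ : Equiv.Perm (Fin (2 * m)), ((Equiv.Perm.sign σ : ℤ) : ℂ) *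
      ∏ i : Fin m, M (σ ⟨2 * (i : ℕ), by omega⟩) (σ ⟨2 * (i : ℕ) + 1, by omega⟩)

end BKP

end

open scoped BigOperators

noncomputable section

namespace BKP

/-! ## Canonical anticommutation relations -/

namespace Maya

/-! This is Wick's theorem for the group element G = γ(2t) ĥ(A). Two facts carry it: G fixes the
vacuum, and it carries each neutral fermion to a linear combination of neutral fermions. So ⟨0|G
φ_{α_1}⋯φ_{α_r}|0⟩ = ⟨0|Y_1⋯Y_r|0⟩ with every Y_i linear in the φ's. On the dual vacuum, Y_1 can be
replaced by an operator that kills |0⟩ and has scalar anticommutators with the φ's. Moving it to the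
right gives the expansion of a Pfaffian along its first row (`wick_expansion`). A permutation
argument turns this recursion into the sum over S_{2m} (`eq_pfaffian_of_expansion`), and the
prefactor 2^{-m} is absorbed by scaling the matrix.

The analytic issue is that conjugation by G may yield infinite combinations of fermions. The energy
grading controls this: φ_j shifts energy by j, energies are nonnegative, and the exponents of both
factors of G lower energy by at least 1. On vectors of energy at most N every sum is therefore
finite. Statements about commutators and conjugation (`IsBosonic`, `IsGroupLike`) are accordingly
made for each N, with a finite combination that may depend on N. Since a state of r fermions has
bounded energy, one N suffices for each identity. -/

theorem ext_carrier {S T : Maya} (h : S.carrier = T.carrier) : S = T := by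
  cases S; cases T; cases h; rfl

theorem finite_right (j : ℤ) (S : Maya) : {k : ℤ | j < k ∧ k ∈ S.carrier}.Finite := by
  refine (S.finite_particles.union (Set.finite_Ioo j 0)).subset ?_
  rintro k ⟨hk, hS⟩
  by_cases h : 0 ≤ k
  · exact Or.inl ⟨h, hS⟩
  · exact Or.inr ⟨hk, not_le.mp h⟩

theorem sign_mul_self (j : ℤ) (S : Maya) : sign j S * sign j S = 1 := by
  rw [sign, ← mul_pow]; simp

theorem sign_add (j : ℤ) {k : ℤ} {S : Maya} (hk : k ∉ S.carrier) :
    sign j (S.add k) = (if j < k then -1 else 1) * sign j S := by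
  unfold sign
  split_ifs with h
  · have : {l : ℤ | j < l ∧ l ∈ (S.add k).carrier} =
        insert k {l : ℤ | j < l ∧ l ∈ S.carrier} := by
      ext l
      simp only [add, Set.mem_ofPred_eq, Set.mem_insert_iff]
      constructor
      · rintro ⟨h1, h2 | h2⟩
        · exact Or.inl h2
        · exact Or.inr ⟨h1, h2⟩
      · rintro (h1 | h1)
        · exact ⟨h1 ▸ h, Or.inl h1⟩
        · exact ⟨h1.1, Or.inr h1.2⟩
    rw [this, Set.ncard_insert_of_notMem (fun h' => hk h'.2) (S.finite_right j), pow_succ]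
    ring
  · have : {l : ℤ | j < l ∧ l ∈ (S.add k).carrier} = {l : ℤ | j < l ∧ l ∈ S.carrier} := by
      ext l
      simp only [add, Set.mem_ofPred_eq, Set.mem_insert_iff]
      constructor
      · rintro ⟨h1, h2 | h2⟩
        · exact absurd (h2 ▸ h1) h
        · exact ⟨h1, h2⟩
      · exact fun h1 => ⟨h1.1, Or.inr h1.2⟩
    rw [this, one_mul]

theorem notMem_del (k : ℤ) (S : Maya) : k ∉ (S.del k).carrier := fun h => h.2 rfl

theorem mem_add (k : ℤ) (S : Maya) : k ∈ (S.add k).carrier := Set.mem_insert _ _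

theorem mem_add_of_ne {j k : ℤ} (h : j ≠ k) (S : Maya) :
    j ∈ (S.add k).carrier ↔ j ∈ S.carrier := by
  simp [add, h]

theorem mem_del_of_ne {j k : ℤ} (h : j ≠ k) (S : Maya) :
    j ∈ (S.del k).carrier ↔ j ∈ S.carrier := by
  simp [del, h]

theorem add_del {k : ℤ} {S : Maya} (hk : k ∈ S.carrier) : (S.del k).add k = S :=
  ext_carrier (by simp [add, del, Set.insert_eq_of_mem hk])

theorem del_add {k : ℤ} {S : Maya} (hk : k ∉ S.carrier) : (S.add k).del k = S :=
  ext_carrier (by simp [add, del, hk])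

theorem add_comm (j k : ℤ) (S : Maya) : (S.add j).add k = (S.add k).add j :=
  ext_carrier (Set.insert_comm _ _ _)

theorem del_comm (j k : ℤ) (S : Maya) : (S.del j).del k = (S.del k).del j :=
  ext_carrier (by simp only [del, Set.sdiff_sdiff, Set.union_comm])

theorem add_del_comm {j k : ℤ} (h : j ≠ k) (S : Maya) :
    (S.add j).del k = (S.del k).add j :=
  ext_carrier (by simp only [add, del]; exact Set.insert_sdiff_of_notMem _ (by simpa using h))

theorem sign_del (j : ℤ) {k : ℤ} {S : Maya} (hk : k ∈ S.carrier) :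
    sign j (S.del k) = (if j < k then -1 else 1) * sign j S := by
  have h := sign_add j (notMem_del k S)
  rw [add_del hk] at h
  rw [h]
  split_ifs <;> ring

end Maya

/-! ### Fermion operators on basis wedges and their anticommutators. -/

theorem end_ext {X Y : Module.End ℂ Fock} (h : ∀ S, X (ket S) = Y (ket S)) : X = Y :=
  Finsupp.lhom_ext' fun S => LinearMap.ext_ring (h S)

theorem psi_ket_of_mem {j : ℤ} {S : Maya} (h : j ∈ S.carrier) : psi j (ket S) = 0 := by
  simp [psi, ket, h]

theorem psi_ket_of_notMem {j : ℤ} {S : Maya} (h : j ∉ S.carrier) :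
    psi j (ket S) = Maya.sign j S • ket (S.add j) := by
  simp [psi, ket, h]

theorem psiDag_ket_of_mem {j : ℤ} {S : Maya} (h : j ∈ S.carrier) :
    psiDag j (ket S) = Maya.sign j S • ket (S.del j) := by
  simp [psiDag, ket, h]

theorem psiDag_ket_of_notMem {j : ℤ} {S : Maya} (h : j ∉ S.carrier) :
    psiDag j (ket S) = 0 := by
  simp [psiDag, ket, h]

/-- Of two distinct sites exactly one lies to the right of the other. This is the whole source of
the minus sign in the anticommutation relations. -/
theorem exchange_sign {j k : ℤ} (h : j ≠ k) :
    (if j < k then (-1 : ℂ) else 1) = -(if k < j then (-1 : ℂ) else 1) := by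
  rcases lt_or_gt_of_ne h with h | h <;> simp [h, h.not_gt]

theorem psi_anticomm (j k : ℤ) : psi j * psi k + psi k * psi j = 0 := by
  refine end_ext fun S => ?_
  simp only [LinearMap.add_apply, Module.End.mul_apply, LinearMap.zero_apply]
  by_cases hjk : j = k
  · subst hjk
    by_cases hj : j ∈ S.carrier
    · simp [psi_ket_of_mem hj]
    · simp [psi_ket_of_notMem hj, psi_ket_of_mem (Maya.mem_add j S)]
  · have hkj : k ≠ j := Ne.symm hjk
    by_cases hj : j ∈ S.carrier <;> by_cases hk : k ∈ S.carrier
    · simp [psi_ket_of_mem hj, psi_ket_of_mem hk]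
    · simp [psi_ket_of_mem hj, psi_ket_of_notMem hk,
        psi_ket_of_mem ((Maya.mem_add_of_ne hjk S).2 hj)]
    · simp [psi_ket_of_mem hk, psi_ket_of_notMem hj,
        psi_ket_of_mem ((Maya.mem_add_of_ne hkj S).2 hk)]
    · rw [psi_ket_of_notMem hj, psi_ket_of_notMem hk, map_smul, map_smul,
        psi_ket_of_notMem (mt (Maya.mem_add_of_ne hjk S).1 hj),
        psi_ket_of_notMem (mt (Maya.mem_add_of_ne hkj S).1 hk), Maya.sign_add _ hk,
        Maya.sign_add _ hj, Maya.add_comm j k, exchange_sign hjk, smul_smul, smul_smul,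
        ← add_smul]
      convert zero_smul ℂ _ using 2
      ring

theorem psiDag_anticomm (j k : ℤ) : psiDag j * psiDag k + psiDag k * psiDag j = 0 := by
  refine end_ext fun S => ?_
  simp only [LinearMap.add_apply, Module.End.mul_apply, LinearMap.zero_apply]
  by_cases hjk : j = k
  · subst hjk
    by_cases hj : j ∈ S.carrier
    · simp [psiDag_ket_of_mem hj, psiDag_ket_of_notMem (Maya.notMem_del j S)]
    · simp [psiDag_ket_of_notMem hj]
  · have hkj : k ≠ j := Ne.symm hjk
    by_cases hj : j ∈ S.carrier <;> by_cases hk : k ∈ S.carrier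
    · rw [psiDag_ket_of_mem hj, psiDag_ket_of_mem hk, map_smul, map_smul,
        psiDag_ket_of_mem ((Maya.mem_del_of_ne hjk S).2 hj),
        psiDag_ket_of_mem ((Maya.mem_del_of_ne hkj S).2 hk), Maya.sign_del _ hk,
        Maya.sign_del _ hj, Maya.del_comm j k, exchange_sign hjk, smul_smul, smul_smul,
        ← add_smul]
      convert zero_smul ℂ _ using 2
      ring
    · simp [psiDag_ket_of_mem hj, psiDag_ket_of_notMem hk,
        psiDag_ket_of_notMem (mt (Maya.mem_del_of_ne hkj S).1 hk)]
    · simp [psiDag_ket_of_mem hk, psiDag_ket_of_notMem hj,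
        psiDag_ket_of_notMem (mt (Maya.mem_del_of_ne hjk S).1 hj)]
    · simp [psiDag_ket_of_notMem hj, psiDag_ket_of_notMem hk]

theorem psi_psiDag_anticomm (j k : ℤ) :
    psi j * psiDag k + psiDag k * psi j = (if j = k then (1 : ℂ) else 0) • 1 := by
  refine end_ext fun S => ?_
  simp only [LinearMap.add_apply, Module.End.mul_apply, LinearMap.smul_apply,
    Module.End.one_apply]
  by_cases hjk : j = k
  · subst hjk
    by_cases hj : j ∈ S.carrier
    · rw [psiDag_ket_of_mem hj, psi_ket_of_mem hj, map_smul,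
        psi_ket_of_notMem (Maya.notMem_del j S), Maya.sign_del _ hj, Maya.add_del hj, smul_smul]
      simp [Maya.sign_mul_self]
    · rw [psiDag_ket_of_notMem hj, psi_ket_of_notMem hj, map_smul,
        psiDag_ket_of_mem (Maya.mem_add j S), Maya.sign_add _ hj, Maya.del_add hj, smul_smul]
      simp [Maya.sign_mul_self]
  · have hkj : k ≠ j := Ne.symm hjk
    rw [if_neg hjk, zero_smul]
    by_cases hj : j ∈ S.carrier <;> by_cases hk : k ∈ S.carrier
    · simp [psi_ket_of_mem hj, psiDag_ket_of_mem hk,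
        psi_ket_of_mem ((Maya.mem_del_of_ne hjk S).2 hj)]
    · simp [psi_ket_of_mem hj, psiDag_ket_of_notMem hk]
    · rw [psiDag_ket_of_mem hk, psi_ket_of_notMem hj, map_smul, map_smul,
        psi_ket_of_notMem (mt (Maya.mem_del_of_ne hjk S).1 hj),
        psiDag_ket_of_mem ((Maya.mem_add_of_ne hkj S).2 hk), Maya.sign_del _ hk,
        Maya.sign_add _ hj, Maya.add_del_comm hjk, exchange_sign hjk, smul_smul, smul_smul,
        ← add_smul]
      convert zero_smul ℂ _ using 2
      ring
    · simp [psiDag_ket_of_notMem hk, psi_ket_of_notMem hj,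
        psiDag_ket_of_notMem (mt (Maya.mem_add_of_ne hkj S).1 hk)]

/-- Both species of neutral fermions have the form `u (ψ_j + ε (-1)^j ψ†_{-j})`. -/
theorem exists_phi_eq (s : Species) : ∃ u ε : ℂ, ∀ j : ℤ,
    phi s j = u • (psi j + (ε * (-1 : ℂ) ^ j) • psiDag (-j)) := by
  cases s
  · exact ⟨1 / (Real.sqrt 2 : ℂ), 1, fun j => by simp only [phi, one_mul]⟩
  · exact ⟨Complex.I / (Real.sqrt 2 : ℂ), -1, fun j => by
      refine LinearMap.ext fun v => ?_
      simp only [phi, LinearMap.smul_apply, LinearMap.sub_apply, LinearMap.add_apply]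
      module⟩

/-- Wick's theorem needs only that the anticommutator is a scalar, and the degree bounds need only
that it vanishes off j + k = 0. Its actual value is left existential. -/
theorem exists_phi_anticomm (s : Species) (j k : ℤ) : ∃ c : ℂ,
    phi s j * phi s k + phi s k * phi s j = c • 1 ∧ (j + k ≠ 0 → c = 0) := by
  obtain ⟨u, ε, h⟩ := exists_phi_eq s
  have h1 := psi_psiDag_anticomm j (-k)
  have h2 := psi_psiDag_anticomm k (-j)
  have h3 := psi_anticomm j k
  have h4 := psiDag_anticomm (-j) (-k)
  refine ⟨u * u * (ε * (-1) ^ k * (if j = -k then 1 else 0) +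
    ε * (-1) ^ j * (if k = -j then 1 else 0)), ?_, fun hjk => ?_⟩
  · rw [h, h]
    have : (u • (psi j + (ε * (-1) ^ j) • psiDag (-j))) * (u • (psi k + (ε * (-1) ^ k) • psiDag (-k)))
        + (u • (psi k + (ε * (-1) ^ k) • psiDag (-k))) * (u • (psi j + (ε * (-1) ^ j) • psiDag (-j)))
        = (u * u) • ((psi j * psi k + psi k * psi j)
          + (ε * (-1) ^ k) • (psi j * psiDag (-k) + psiDag (-k) * psi j)
          + (ε * (-1) ^ j) • (psi k * psiDag (-j) + psiDag (-j) * psi k)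
          + (ε * (-1) ^ j * (ε * (-1) ^ k)) •
            (psiDag (-j) * psiDag (-k) + psiDag (-k) * psiDag (-j))) := by
      simp only [smul_mul_assoc, mul_smul_comm, mul_add, add_mul, smul_add, smul_smul]
      module
    rw [this, h1, h2, h3, h4]
    module
  · rw [if_neg (by omega), if_neg (by omega)]
    ring

/-- Prepares the zero mode: φ_0 does not kill the vacuum, so ψ†_0 will stand in for it on the dual
vacuum. -/
theorem exists_psiDag_zero_phi_anticomm (s : Species) (k : ℤ) : ∃ c : ℂ,
    psiDag 0 * phi s k + phi s k * psiDag 0 = c • 1 := by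
  obtain ⟨u, ε, h⟩ := exists_phi_eq s
  refine ⟨u * (if k = 0 then 1 else 0), ?_⟩
  have : psiDag 0 * phi s k + phi s k * psiDag 0
      = u • ((psi k * psiDag 0 + psiDag 0 * psi k) + (ε * (-1) ^ k) •
        (psiDag 0 * psiDag (-k) + psiDag (-k) * psiDag 0)) := by
    rw [h]
    simp only [smul_mul_assoc, mul_smul_comm, mul_add, add_mul, smul_add, smul_smul]
    module
  rw [this, psi_psiDag_anticomm, psiDag_anticomm]
  module

/-! ## The energy filtration -/

open Classical in
/-- The contribution of the site `k` to the energy: particles at `k ≥ 0` count `k`, holes at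
`k < 0` count `-k`. -/
def siteEnergy (S : Maya) (k : ℤ) : ℤ :=
  if 0 ≤ k then (if k ∈ S.carrier then k else 0) else (if k ∈ S.carrier then 0 else -k)

/-- The energy of a semi-infinite wedge. -/
def energy (S : Maya) : ℤ := ∑ᶠ k, siteEnergy S k

theorem siteEnergy_nonneg (S : Maya) (k : ℤ) : 0 ≤ siteEnergy S k := by
  unfold siteEnergy; split_ifs <;> omega

theorem energy_nonneg (S : Maya) : 0 ≤ energy S := finsum_nonneg (siteEnergy_nonneg S)

theorem siteEnergy_support_finite (S : Maya) : (Function.support (siteEnergy S)).Finite := by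
  refine (S.finite_particles.union S.finite_holes).subset fun k hk => ?_
  rw [Function.mem_support, siteEnergy] at hk
  by_cases h0 : 0 ≤ k <;> by_cases h1 : k ∈ S.carrier <;> simp_all

theorem energy_vac : energy Maya.vac = 0 := by
  unfold energy
  refine finsum_eq_zero_of_forall_eq_zero fun k => ?_
  unfold siteEnergy Maya.vac
  split_ifs with h1 h2 h2 <;> simp_all
  omega

/-- One formula covers both signs of j: for j < 0, filling the site removes a hole of energy -j. -/
theorem energy_add {j : ℤ} {S : Maya} (hj : j ∉ S.carrier) :
    energy (S.add j) = energy S + j := by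
  classical
  have h : siteEnergy (S.add j) = fun k => siteEnergy S k + (if k = j then j else 0) := by
    funext k
    by_cases hk : k = j
    · subst hk
      simp only [siteEnergy, Maya.mem_add, hj, if_true, if_false]
      split_ifs <;> omega
    · simp only [siteEnergy, Maya.mem_add_of_ne hk, hk, if_false, add_zero]
  have hfin : (Function.support fun k : ℤ => if k = j then j else 0).Finite :=
    (Set.finite_singleton j).subset fun k hk => by
      by_contra hne
      exact hk (if_neg hne)
  unfold energy
  rw [h, finsum_add_distrib (siteEnergy_support_finite S) hfin]
  congr 1
  rw [finsum_eq_single _ j (fun k hk => if_neg hk), if_pos rfl]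

theorem energy_del {j : ℤ} {S : Maya} (hj : j ∈ S.carrier) :
    energy (S.del j) = energy S - j := by
  have h := energy_add (Maya.notMem_del j S)
  rw [Maya.add_del hj] at h
  omega

/-- The span of the semi-infinite wedges of energy at most `N`. -/
def energyLE (N : ℤ) : Submodule ℂ Fock := Finsupp.supported ℂ ℂ {S | energy S ≤ N}

theorem ket_mem_energyLE {S : Maya} {N : ℤ} (h : energy S ≤ N) : ket S ∈ energyLE N :=
  Finsupp.single_mem_supported ℂ _ h

theorem vacuum_mem_energyLE {N : ℤ} (h : 0 ≤ N) : vacuum ∈ energyLE N :=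
  ket_mem_energyLE (energy_vac.trans_le h)

theorem energyLE_mono {M N : ℤ} (h : M ≤ N) : energyLE M ≤ energyLE N :=
  Finsupp.supported_mono fun _ hS => le_trans hS h

/-- The source of all local finiteness and of all truncations below. -/
theorem eq_zero_of_mem_energyLE {N : ℤ} (hN : N < 0) {v : Fock} (hv : v ∈ energyLE N) : v = 0 := by
  have h : {S | energy S ≤ N} = ∅ := by
    ext S
    simpa using hN.trans_le (energy_nonneg S)
  rw [energyLE, h, Finsupp.supported_empty] at hv
  exact hv

theorem exists_mem_energyLE (v : Fock) : ∃ N : ℕ, v ∈ energyLE N := by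
  refine ⟨∑ S ∈ v.support, (energy S).toNat, fun S hS => ?_⟩
  have h := Finset.single_le_sum (f := fun S => (energy S).toNat) (fun _ _ => Nat.zero_le _) hS
  simp only [Set.mem_ofPred_eq]
  have := Int.self_le_toNat (energy S)
  exact this.trans (by exact_mod_cast h)

theorem map_energyLE {X : Module.End ℂ Fock} {M N : ℤ}
    (h : ∀ S, energy S ≤ N → X (ket S) ∈ energyLE M) {v : Fock} (hv : v ∈ energyLE N) :
    X v ∈ energyLE M := by
  rw [energyLE, Finsupp.supported_eq_span_single] at hv
  have : Submodule.span ℂ ((fun i => Finsupp.single i (1 : ℂ)) '' {S | energy S ≤ N}) ≤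
      (energyLE M).comap X := by
    rw [Submodule.span_le]
    rintro _ ⟨S, hS, rfl⟩
    exact h S hS
  exact this hv

theorem psi_mem_energyLE (j : ℤ) {N : ℤ} {v : Fock} (hv : v ∈ energyLE N) :
    psi j v ∈ energyLE (N + j) := by
  refine map_energyLE (fun S hS => ?_) hv
  by_cases hj : j ∈ S.carrier
  · rw [psi_ket_of_mem hj]; exact zero_mem _
  · rw [psi_ket_of_notMem hj]
    exact Submodule.smul_mem _ _ (ket_mem_energyLE (by rw [energy_add hj]; omega))

theorem psiDag_mem_energyLE (j : ℤ) {N : ℤ} {v : Fock} (hv : v ∈ energyLE N) :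
    psiDag j v ∈ energyLE (N - j) := by
  refine map_energyLE (fun S hS => ?_) hv
  by_cases hj : j ∈ S.carrier
  · rw [psiDag_ket_of_mem hj]
    exact Submodule.smul_mem _ _ (ket_mem_energyLE (by rw [energy_del hj]; omega))
  · rw [psiDag_ket_of_notMem hj]; exact zero_mem _

theorem phi_mem_energyLE (s : Species) (j : ℤ) {N : ℤ} {v : Fock} (hv : v ∈ energyLE N) :
    phi s j v ∈ energyLE (N + j) := by
  obtain ⟨u, ε, h⟩ := exists_phi_eq s
  rw [h]
  refine Submodule.smul_mem _ _ (Submodule.add_mem _ (psi_mem_energyLE j hv)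
    (Submodule.smul_mem _ _ ?_))
  simpa using psiDag_mem_energyLE (-j) hv

/-! ## Pfaffians and anticommuting families -/

theorem prod_ofFn_comp_swap {R : Type*} [Ring R] : ∀ {n : ℕ} (Y : Fin (n + 1) → R),
    (∀ i j, i ≠ j → Y i * Y j = -(Y j * Y i)) → ∀ i : Fin n,
    (List.ofFn fun k => Y (Equiv.swap i.castSucc i.succ k)).prod = -(List.ofFn Y).prod
  | 0, _, _, i => i.elim0
  | n + 1, Y, h, i => by
    refine Fin.cases ?_ (fun i => ?_) i
    · have hk : ∀ k : Fin n, Equiv.swap (0 : Fin (n + 2)) 1 k.succ.succ = k.succ.succ := fun k =>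
        Equiv.swap_apply_of_ne_of_ne (Fin.succ_ne_zero _)
          (by simp [Fin.ext_iff])
      simp only [Fin.castSucc_zero, Fin.succ_zero_eq_one, List.ofFn_succ, List.prod_cons,
        Equiv.swap_apply_left, Equiv.swap_apply_right, hk]
      rw [← mul_assoc, ← mul_assoc, h 1 0 (by simp), neg_mul]
    · have h0 : Equiv.swap i.succ.castSucc i.succ.succ 0 = 0 :=
        Equiv.swap_apply_of_ne_of_ne (by simp [Fin.ext_iff]) (Fin.succ_ne_zero _).symm
      have hk : ∀ k : Fin (n + 1), Equiv.swap i.succ.castSucc i.succ.succ k.succ =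
          (Equiv.swap i.castSucc i.succ k).succ := fun k => by
        rw [← Fin.succ_castSucc]
        exact ((Fin.succ_injective _).swap_apply _ _ _)
      rw [List.ofFn_succ, List.ofFn_succ (f := Y), List.prod_cons, List.prod_cons, h0]
      simp only [hk]
      rw [prod_ofFn_comp_swap (fun k => Y k.succ)
        (fun a b hab => h _ _ fun h' => hab (Fin.succ_injective _ h')) i, mul_neg]

/-- Adjacent transpositions generate the symmetric group, and permuting an anticommuting family
leaves it anticommuting. -/
theorem prod_ofFn_comp_perm {R : Type*} [Ring R] {n : ℕ} (σ : Equiv.Perm (Fin n))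
    (Y : Fin n → R) (h : ∀ i j, i ≠ j → Y i * Y j = -(Y j * Y i)) :
    (List.ofFn fun k => Y (σ k)).prod = ((Equiv.Perm.sign σ : ℤ) : R) * (List.ofFn Y).prod := by
  cases n with
  | zero => simp [Subsingleton.elim σ 1]
  | succ n =>
    have hσ : σ ∈ Submonoid.closure
        (Set.range fun i : Fin n => Equiv.swap i.castSucc i.succ) := by
      rw [Equiv.Perm.mclosure_swap_castSucc_succ]; trivial
    induction hσ using Submonoid.closure_induction generalizing Y with
    | mem σ hσ =>
      obtain ⟨i, rfl⟩ := hσ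
      have hne : i.castSucc ≠ i.succ := (Fin.castSucc_lt_succ).ne
      rw [prod_ofFn_comp_swap Y h i, Equiv.Perm.sign_swap hne]
      simp
    | one => simp
    | mul σ τ _ _ hσ hτ =>
      have := hτ (fun k => Y (σ k)) fun i j hij => h _ _ fun h' => hij (σ.injective h')
      simp only [Equiv.Perm.mul_apply]
      rw [this, hσ Y h, Equiv.Perm.sign_mul, ← mul_assoc]
      push_cast
      rw [← Int.cast_mul, ← Int.cast_mul, mul_comm]

/-- The permutation of `Fin (n + 1)` that fixes `0` and acts as `σ` on the other elements. -/
def permSucc {n : ℕ} (σ : Equiv.Perm (Fin n)) : Equiv.Perm (Fin (n + 1)) :=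
  Equiv.Perm.decomposeFin.symm (0, σ)

theorem permSucc_zero {n : ℕ} (σ : Equiv.Perm (Fin n)) : permSucc σ 0 = 0 :=
  Equiv.Perm.decomposeFin_symm_apply_zero _ _

theorem permSucc_succ {n : ℕ} (σ : Equiv.Perm (Fin n)) (k : Fin n) :
    permSucc σ k.succ = (σ k).succ := by
  simp [permSucc]

theorem sign_permSucc {n : ℕ} (σ : Equiv.Perm (Fin n)) :
    Equiv.Perm.sign (permSucc σ) = Equiv.Perm.sign σ := by
  simp [permSucc]

/-- The Pfaffian summand of a permutation. -/
def pfaffianTerm {m : ℕ} (M : Matrix (Fin (2 * m)) (Fin (2 * m)) ℂ)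
    (σ : Equiv.Perm (Fin (2 * m))) : ℂ :=
  ((Equiv.Perm.sign σ : ℤ) : ℂ) *
    ∏ i : Fin m, M (σ ⟨2 * (i : ℕ), by omega⟩) (σ ⟨2 * (i : ℕ) + 1, by omega⟩)

theorem pfaffian_eq_sum_pfaffianTerm {m : ℕ} (M : Matrix (Fin (2 * m)) (Fin (2 * m)) ℂ) :
    pfaffian M = (1 / ((2 : ℂ) ^ m * (m.factorial : ℂ))) * ∑ σ, pfaffianTerm M σ := rfl

/-- Splits off the pair in the first two positions. Letting σ act on the remaining positions relates
Pfaffians of sizes 2m and 2m + 2. -/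
theorem pfaffianTerm_mul_permSucc {ι : Type*} {m : ℕ} (c : ι → ι → ℂ)
    (y : Fin (2 * (m + 1)) → ι) (τ : Equiv.Perm (Fin (2 * (m + 1))))
    (σ : Equiv.Perm (Fin (2 * m))) :
    pfaffianTerm (Matrix.of fun i j => c (y i) (y j))
        (τ * (permSucc (permSucc σ) : Equiv.Perm (Fin (2 * m + 2)))) =
      ((Equiv.Perm.sign τ : ℤ) : ℂ) * c (y (τ (0 : Fin (2 * m + 2)))) (y (τ (1 : Fin (2 * m + 2))))
        * pfaffianTerm (Matrix.of fun i j : Fin (2 * m) =>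
          c (y (τ (i.succ.succ : Fin (2 * m + 2)))) (y (τ (j.succ.succ : Fin (2 * m + 2))))) σ := by
  have hs : Equiv.Perm.sign (τ * (permSucc (permSucc σ) : Equiv.Perm (Fin (2 * m + 2)))) =
      Equiv.Perm.sign τ * Equiv.Perm.sign σ := by
    rw [Equiv.Perm.sign_mul]
    congr 1
    exact (sign_permSucc _).trans (sign_permSucc _)
  unfold pfaffianTerm
  rw [hs, Fin.prod_univ_succ]
  have h0 : (permSucc (permSucc σ)) (0 : Fin (2 * m + 2)) = 0 := permSucc_zero _
  have h1 : (permSucc (permSucc σ)) (1 : Fin (2 * m + 2)) = 1 := by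
    rw [← Fin.succ_zero_eq_one, permSucc_succ, permSucc_zero]
  have hk : ∀ k : Fin (2 * m), (permSucc (permSucc σ)) k.succ.succ = (σ k).succ.succ := fun k => by
    rw [permSucc_succ, permSucc_succ]
  have e0 : (⟨2 * ((0 : Fin (m + 1)) : ℕ), by simp⟩ : Fin (2 * m + 2)) = 0 := by
    ext; simp
  have e1 : (⟨2 * ((0 : Fin (m + 1)) : ℕ) + 1, by simp⟩ : Fin (2 * m + 2)) = 1 := by
    ext; simp
  have e2 : ∀ i : Fin m, (⟨2 * (i.succ : ℕ), by rw [Fin.val_succ]; omega⟩ : Fin (2 * m + 2)) =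
      (⟨2 * (i : ℕ), by omega⟩ : Fin (2 * m)).succ.succ := fun i => by
    ext; simp; ring
  have e3 : ∀ i : Fin m, (⟨2 * (i.succ : ℕ) + 1, by rw [Fin.val_succ]; omega⟩ : Fin (2 * m + 2)) =
      (⟨2 * (i : ℕ) + 1, by omega⟩ : Fin (2 * m)).succ.succ := fun i => by
    ext; simp; ring
  have p0 : ∀ h, (τ * (permSucc (permSucc σ) : Equiv.Perm (Fin (2 * m + 2))))
      (⟨2 * ((0 : Fin (m + 1)) : ℕ), h⟩ : Fin (2 * m + 2)) = τ (0 : Fin (2 * m + 2)) := fun h => by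
    rw [Equiv.Perm.mul_apply, e0, h0]
  have p1 : ∀ h, (τ * (permSucc (permSucc σ) : Equiv.Perm (Fin (2 * m + 2))))
      (⟨2 * ((0 : Fin (m + 1)) : ℕ) + 1, h⟩ : Fin (2 * m + 2)) = τ (1 : Fin (2 * m + 2)) :=
    fun h => by rw [Equiv.Perm.mul_apply, e1, h1]
  have p2 : ∀ (i : Fin m) h, (τ * (permSucc (permSucc σ) : Equiv.Perm (Fin (2 * m + 2))))
      (⟨2 * (i.succ : ℕ), h⟩ : Fin (2 * m + 2)) =
      τ ((σ ⟨2 * (i : ℕ), by omega⟩).succ.succ : Fin (2 * m + 2)) := fun i h => by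
    rw [Equiv.Perm.mul_apply, e2, hk]
  have p3 : ∀ (i : Fin m) h, (τ * (permSucc (permSucc σ) : Equiv.Perm (Fin (2 * m + 2))))
      (⟨2 * (i.succ : ℕ) + 1, h⟩ : Fin (2 * m + 2)) =
      τ ((σ ⟨2 * (i : ℕ) + 1, by omega⟩).succ.succ : Fin (2 * m + 2)) := fun i h => by
    rw [Equiv.Perm.mul_apply, e3, hk]
  simp only [Matrix.of_apply]
  erw [p0, p1, Finset.prod_congr rfl fun i _ => by erw [p2 i, p3 i]]
  push_cast
  ring

/-- An alternating function that satisfies the expansion of a Pfaffian along its first row is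
the Pfaffian of its values on pairs. -/
theorem eq_pfaffian_of_expansion {ι : Type*} (g : ∀ n, (Fin n → ι) → ℂ)
    (h0 : ∀ y, g 0 y = 1)
    (hanti : ∀ n (y : Fin n → ι), Function.Injective y → ∀ σ : Equiv.Perm (Fin n),
      g n (fun k => y (σ k)) = ((Equiv.Perm.sign σ : ℤ) : ℂ) * g n y)
    (hexp : ∀ n (y : Fin (n + 2) → ι), g (n + 2) y = ∑ j : Fin (n + 1),
      (-1) ^ (j : ℕ) * g 2 ![y 0, y j.succ] * g n fun k => y (j.succAbove k).succ) :
    ∀ m (y : Fin (2 * m) → ι), Function.Injective y →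
      g (2 * m) y = pfaffian (Matrix.of fun i j => g 2 ![y i, y j])
  | 0, y, _ => by
    simp [pfaffian, h0 y]
  | m + 1, y, hy => by
    have IH := eq_pfaffian_of_expansion g h0 hanti hexp m
    set P := ∑ τ, pfaffianTerm (Matrix.of fun i j => g 2 ![y i, y j]) τ with hP
    let F : Equiv.Perm (Fin (2 * m + 2)) → ℂ := fun τ => ((Equiv.Perm.sign τ : ℤ) : ℂ) *
      g 2 ![y (τ 0), y (τ 1)] * g (2 * m) fun k => y (τ k.succ.succ)
    -- Antisymmetrize the first-row expansion over all rearrangements of y.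
    have hcard : ((2 * m + 2).factorial : ℂ) * g (2 * m + 2) y = (2 * m + 1) * ∑ τ, F τ := by
      have h1 : ∀ τ : Equiv.Perm (Fin (2 * m + 2)), g (2 * m + 2) y =
          ((Equiv.Perm.sign τ : ℤ) : ℂ) * g (2 * m + 2) fun k => y (τ k) := fun τ => by
        rw [hanti (2 * m + 2) y hy τ, ← mul_assoc, ← Int.cast_mul, Int.units_coe_mul_self, Int.cast_one,
          one_mul]
      have h2 : ∑ τ : Equiv.Perm (Fin (2 * m + 2)), g (2 * m + 2) y =
          ((2 * m + 2).factorial : ℂ) * g (2 * m + 2) y := by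
        rw [Finset.sum_const, Finset.card_univ, Fintype.card_perm, Fintype.card_fin, nsmul_eq_mul]
      -- Each column j gives the same sum: the reindexing brings j to position 1 by a cycle whose
      -- sign (-1)^j cancels the sign of the expansion.
      have h3 : ∀ j : Fin (2 * m + 1), ∑ τ : Equiv.Perm (Fin (2 * m + 2)),
          ((Equiv.Perm.sign τ : ℤ) : ℂ) * ((-1) ^ (j : ℕ) * g 2 ![y (τ 0), y (τ j.succ)] *
            g (2 * m) fun k => y (τ (j.succAbove k).succ)) = ∑ τ, F τ := fun j => by
        rw [← Equiv.sum_comp (Equiv.mulRight (permSucc j.cycleRange.symm)) F]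
        refine Finset.sum_congr rfl fun τ _ => ?_
        have e1 : permSucc j.cycleRange.symm 1 = j.succ := by
          rw [← Fin.succ_zero_eq_one, permSucc_succ, Fin.cycleRange_symm_zero]
        simp only [F, Equiv.coe_mulRight, Equiv.Perm.mul_apply, Equiv.Perm.sign_mul, permSucc_zero,
          permSucc_succ, sign_permSucc, Equiv.Perm.sign_symm, Fin.sign_cycleRange,
          Fin.cycleRange_symm_succ, e1]
        push_cast
        ring
      rw [← h2, Finset.sum_congr rfl fun τ _ => h1 τ,
        Finset.sum_congr rfl fun τ _ => by rw [hexp, Finset.mul_sum], Finset.sum_comm,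
        Finset.sum_congr rfl fun j _ => h3 j]
      simp
    have hF : ∑ τ, F τ = (1 / ((2 : ℂ) ^ m * (m.factorial : ℂ))) * ((2 * m).factorial * P) := by
      have h1 : ∀ τ, F τ = ∑ σ : Equiv.Perm (Fin (2 * m)),
          (1 / ((2 : ℂ) ^ m * (m.factorial : ℂ))) *
            pfaffianTerm (Matrix.of fun i j => g 2 ![y i, y j])
              (τ * (permSucc (permSucc σ) : Equiv.Perm (Fin (2 * m + 2)))) := fun τ => by
        have hinj : Function.Injective fun k : Fin (2 * m) => y (τ k.succ.succ) :=
          hy.comp (τ.injective.comp ((Fin.succ_injective _).comp (Fin.succ_injective _)))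
        simp only [F]
        rw [IH _ hinj, pfaffian_eq_sum_pfaffianTerm, mul_left_comm, Finset.mul_sum,
          Finset.mul_sum]
        refine Finset.sum_congr rfl fun σ _ => ?_
        rw [pfaffianTerm_mul_permSucc (fun a b => g 2 ![a, b]) y τ σ]
      rw [Finset.sum_congr rfl fun τ _ => h1 τ, Finset.sum_comm]
      simp only [← Finset.mul_sum]
      congr 1
      -- For fixed σ, right translation permutes the group, so each of the (2m)! choices of σ
      -- contributes the full sum P.
      have h2 : ∀ σ : Equiv.Perm (Fin (2 * m)), ∑ τ : Equiv.Perm (Fin (2 * m + 2)),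
          pfaffianTerm (Matrix.of fun i j => g 2 ![y i, y j])
            (τ * (permSucc (permSucc σ) : Equiv.Perm (Fin (2 * m + 2)))) = P := fun σ =>
        Equiv.sum_comp (Equiv.mulRight (permSucc (permSucc σ)))
          (pfaffianTerm (m := m + 1) (Matrix.of fun i j => g 2 ![y i, y j]))
      rw [Finset.sum_congr rfl fun σ _ => h2 σ, Finset.sum_const, Finset.card_univ,
        Fintype.card_perm, Fintype.card_fin, nsmul_eq_mul]
    rw [pfaffian_eq_sum_pfaffianTerm, ← hP]
    rw [hF] at hcard
    have hm : (m.factorial : ℂ) ≠ 0 := by exact_mod_cast m.factorial_ne_zero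
    have h2m : ((2 * m).factorial : ℂ) ≠ 0 := by exact_mod_cast (2 * m).factorial_ne_zero
    have hm1 : (m : ℂ) + 1 ≠ 0 := by exact_mod_cast m.succ_ne_zero
    have h2m1 : 2 * (m : ℂ) + 1 ≠ 0 := by exact_mod_cast (2 * m).succ_ne_zero
    rw [Nat.factorial_succ, Nat.factorial_succ] at hcard
    rw [Nat.factorial_succ, pow_succ]
    push_cast at hcard ⊢
    change g (2 * m + 2) y = _
    field_simp at hcard ⊢
    linear_combination hcard

/-- The diagonal must be ignored: the matrix of pair functions has diagonal entry 1/2 before scaling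
at a part equal to 0, because φ_0² = 1/2, whereas the matrix in the theorem has zero diagonal. -/
theorem pfaffian_congr {m : ℕ} {M M' : Matrix (Fin (2 * m)) (Fin (2 * m)) ℂ}
    (h : ∀ i j, i ≠ j → M i j = M' i j) : pfaffian M = pfaffian M' := by
  have hσ : ∀ (σ : Equiv.Perm (Fin (2 * m))) (i : Fin m),
      M (σ ⟨2 * (i : ℕ), by omega⟩) (σ ⟨2 * (i : ℕ) + 1, by omega⟩) =
        M' (σ ⟨2 * (i : ℕ), by omega⟩) (σ ⟨2 * (i : ℕ) + 1, by omega⟩) := fun σ i =>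
    h _ _ fun h' => by
      have := congrArg Fin.val (σ.injective h')
      simp at this
  simp only [pfaffian, hσ]

theorem pfaffian_smul {m : ℕ} (c : ℂ) (M : Matrix (Fin (2 * m)) (Fin (2 * m)) ℂ) :
    pfaffian (c • M) = c ^ m * pfaffian M := by
  unfold pfaffian
  simp only [Matrix.smul_apply, smul_eq_mul, Finset.prod_mul_distrib, Finset.prod_const,
    Finset.card_univ, Fintype.card_fin, mul_left_comm _ (c ^ m), ← Finset.mul_sum]

/-! ## Bosonic operators -/

/-- The span of the neutral fermions `φ_j` with `j ≤ d`. -/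
def fermionSpan (s : Species) (d : ℤ) : Submodule ℂ (Module.End ℂ Fock) :=
  Submodule.span ℂ (phi s '' Set.Iic d)

theorem phi_mem_fermionSpan (s : Species) {j d : ℤ} (h : j ≤ d) : phi s j ∈ fermionSpan s d :=
  Submodule.subset_span ⟨j, h, rfl⟩

theorem fermionSpan_mono (s : Species) {d e : ℤ} (h : d ≤ e) : fermionSpan s d ≤ fermionSpan s e :=
  Submodule.span_mono (Set.image_mono (Set.Iic_subset_Iic.2 h))

theorem fermionSpan_induction {s : Species} {d : ℤ} {p : Module.End ℂ Fock → Prop}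
    (hphi : ∀ j ≤ d, p (phi s j)) (hzero : p 0) (hadd : ∀ X Y, p X → p Y → p (X + Y))
    (hsmul : ∀ (c : ℂ) X, p X → p (c • X)) {X : Module.End ℂ Fock} (hX : X ∈ fermionSpan s d) :
    p X := by
  induction hX using Submodule.span_induction with
  | mem x hx => obtain ⟨j, hj, rfl⟩ := hx; exact hphi j hj
  | zero => exact hzero
  | add x y _ _ hx hy => exact hadd x y hx hy
  | smul c x _ hx => exact hsmul c x hx

theorem apply_mem_energyLE {s : Species} {d : ℤ} {X : Module.End ℂ Fock}
    (hX : X ∈ fermionSpan s d) {N : ℤ} {v : Fock} (hv : v ∈ energyLE N) :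
    X v ∈ energyLE (N + d) := by
  refine fermionSpan_induction (p := fun X => X v ∈ energyLE (N + d)) (fun j hj => ?_)
    (zero_mem _) (fun X Y hX hY => add_mem hX hY) (fun c X hX => Submodule.smul_mem _ c hX) hX
  exact energyLE_mono (by omega) (phi_mem_energyLE s j hv)

/-- `B` lowers the energy by `e`, and on vectors of bounded energy its commutator with a linear
combination of neutral fermions of degree at most `d` is one of degree at most `d - e`. -/
structure IsBosonic (s : Species) (e : ℤ) (B : Module.End ℂ Fock) : Prop where
  lower : ∀ {N : ℤ} {v : Fock}, v ∈ energyLE N → B v ∈ energyLE (N - e)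
  comm : ∀ (N : ℤ) {d : ℤ} {X : Module.End ℂ Fock}, X ∈ fermionSpan s d →
    ∃ X' ∈ fermionSpan s (d - e), ∀ v ∈ energyLE N, B (X v) = X (B v) + X' v

namespace IsBosonic

variable {s : Species} {e : ℤ}

theorem zero : IsBosonic s e 0 :=
  ⟨fun _ => zero_mem _, fun _ _ _ _ => ⟨0, zero_mem _, fun v _ => by simp⟩⟩

theorem add {B C : Module.End ℂ Fock} (hB : IsBosonic s e B) (hC : IsBosonic s e C) :
    IsBosonic s e (B + C) := by
  refine ⟨fun hv => add_mem (hB.lower hv) (hC.lower hv), fun N d X hX => ?_⟩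
  obtain ⟨X', hX', h'⟩ := hB.comm N hX
  obtain ⟨X'', hX'', h''⟩ := hC.comm N hX
  refine ⟨X' + X'', add_mem hX' hX'', fun v hv => ?_⟩
  simp only [LinearMap.add_apply, map_add, h' v hv, h'' v hv]
  abel

theorem smul (c : ℂ) {B : Module.End ℂ Fock} (hB : IsBosonic s e B) : IsBosonic s e (c • B) := by
  refine ⟨fun hv => Submodule.smul_mem _ c (hB.lower hv), fun N d X hX => ?_⟩
  obtain ⟨X', hX', h'⟩ := hB.comm N hX
  refine ⟨c • X', Submodule.smul_mem _ c hX', fun v hv => ?_⟩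
  simp only [LinearMap.smul_apply, map_smul, h' v hv, smul_add]

theorem sum {ι : Type*} (F : Finset ι) {B : ι → Module.End ℂ Fock}
    (hB : ∀ i, IsBosonic s e (B i)) : IsBosonic s e (∑ i ∈ F, B i) := by
  classical
  induction F using Finset.induction_on with
  | empty => simpa using zero
  | insert i F hi ih => rw [Finset.sum_insert hi]; exact (hB i).add ih

theorem mono {e' : ℤ} (h : e' ≤ e) {B : Module.End ℂ Fock} (hB : IsBosonic s e B) :
    IsBosonic s e' B := by
  refine ⟨fun hv => energyLE_mono (by omega) (hB.lower hv), fun N d X hX => ?_⟩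
  obtain ⟨X', hX', h'⟩ := hB.comm N hX
  exact ⟨X', fermionSpan_mono s (by omega) hX', h'⟩

theorem of_eqOn {B : Module.End ℂ Fock}
    (h : ∀ N : ℤ, ∃ C, IsBosonic s e C ∧ ∀ v ∈ energyLE N, B v = C v) : IsBosonic s e B := by
  refine ⟨fun {N v} hv => ?_, fun N d X hX => ?_⟩
  · obtain ⟨C, hC, hBC⟩ := h N
    rw [hBC v hv]
    exact hC.lower hv
  -- `B` is applied both to v and to X v, so it must agree with `C` up to both energies.
  · obtain ⟨C, hC, hBC⟩ := h (max N (N + d))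
    obtain ⟨X', hX', h'⟩ := hC.comm N hX
    refine ⟨X', hX', fun v hv => ?_⟩
    rw [hBC v (energyLE_mono (le_max_left _ _) hv),
      hBC _ (energyLE_mono (le_max_right _ _) (apply_mem_energyLE hX hv)), h' v hv]

end IsBosonic

theorem opSum_eq_sum {ι : Type*} {T : ι → Module.End ℂ Fock}
    (hT : ∀ N : ℤ, ∃ F : Finset ι, ∀ i ∉ F, ∀ v ∈ energyLE N, T i v = 0) {N : ℤ} {F : Finset ι}
    (hF : ∀ i ∉ F, ∀ v ∈ energyLE N, T i v = 0) {v : Fock} (hv : v ∈ energyLE N) :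
    opSum T v = (∑ i ∈ F, T i) v := by
  rw [opSum_apply T (fun w => ?_), LinearMap.sum_apply]
  · refine finsum_eq_sum_of_support_subset _ fun i hi => ?_
    by_contra h
    exact hi (hF i h v hv)
  · obtain ⟨M, hM⟩ := exists_mem_energyLE w
    obtain ⟨G, hG⟩ := hT M
    refine G.finite_toSet.subset fun i hi => ?_
    by_contra h
    exact hi (hG i h w hM)

theorem IsBosonic.opSum {ι : Type*} {s : Species} {e : ℤ} {T : ι → Module.End ℂ Fock}
    (hB : ∀ i, IsBosonic s e (T i))
    (hT : ∀ N : ℤ, ∃ F : Finset ι, ∀ i ∉ F, ∀ v ∈ energyLE N, T i v = 0) :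
    IsBosonic s e (opSum T) :=
  .of_eqOn fun N => by
    obtain ⟨F, hF⟩ := hT N
    exact ⟨_, .sum F hB, fun v hv => opSum_eq_sum hT hF hv⟩

/-! ### Quadratic expressions in neutral fermions. -/

theorem phi_apply_eq_zero (s : Species) {j N : ℤ} (h : N + j < 0) {v : Fock}
    (hv : v ∈ energyLE N) : phi s j v = 0 :=
  eq_zero_of_mem_energyLE h (phi_mem_energyLE s j hv)

theorem phi_anticomm_of_ne (s : Species) {j k : ℤ} (h : j + k ≠ 0) :
    phi s j * phi s k = -(phi s k * phi s j) := by
  obtain ⟨c, hc, hc0⟩ := exists_phi_anticomm s j k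
  rw [hc0 h, zero_smul] at hc
  exact LinearMap.ext fun v => eq_neg_of_add_eq_zero_left (LinearMap.congr_fun hc v)

/-- When j + k ≠ 0 either factor may be made to act first, so one sufficiently negative index kills
the vector. -/
theorem phi_mul_phi_apply_eq_zero (s : Species) {j k N : ℤ} (hjk : j + k ≠ 0)
    (h : N + j < 0 ∨ N + k < 0) {v : Fock} (hv : v ∈ energyLE N) :
    (phi s j * phi s k) v = 0 := by
  rcases h with h | h
  · rw [phi_anticomm_of_ne s hjk, LinearMap.neg_apply, Module.End.mul_apply,
      phi_apply_eq_zero s h hv, map_zero, neg_zero]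
  · rw [Module.End.mul_apply, phi_apply_eq_zero s h hv, map_zero]

theorem IsBosonic.phi_mul_phi (s : Species) (j k : ℤ) :
    IsBosonic s (-(j + k)) (phi s j * phi s k) := by
  refine ⟨fun {N v} hv => ?_, fun N d X hX => ?_⟩
  · have := phi_mem_energyLE s j (phi_mem_energyLE s k hv)
    rwa [show N - -(j + k) = N + k + j by ring]
  · suffices h : ∃ X' ∈ fermionSpan s (d - -(j + k)),
        phi s j * phi s k * X = X * (phi s j * phi s k) + X' by
      obtain ⟨X', hX', h⟩ := h
      exact ⟨X', hX', fun v _ => LinearMap.congr_fun h v⟩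
    refine fermionSpan_induction (p := fun X => ∃ X' ∈ fermionSpan s (d - -(j + k)),
      phi s j * phi s k * X = X * (phi s j * phi s k) + X') (fun l hl => ?_)
      ⟨0, zero_mem _, by simp⟩ ?_ ?_ hX
    · obtain ⟨a, ha, ha0⟩ := exists_phi_anticomm s k l
      obtain ⟨b, hb, hb0⟩ := exists_phi_anticomm s j l
      -- From φ_jφ_kφ_l = φ_lφ_jφ_k + aφ_j - bφ_k. Here a ≠ 0 forces k + l = 0, so j = (j + k) + l;
      -- similarly for b. This gives the degree bound.
      refine ⟨a • phi s j + (-b) • phi s k, add_mem ?_ ?_, LinearMap.ext fun v => ?_⟩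
      · by_cases h : k + l = 0
        · exact Submodule.smul_mem _ _ (phi_mem_fermionSpan s (by omega))
        · simp [ha0 h]
      · by_cases h : j + l = 0
        · exact Submodule.smul_mem _ _ (phi_mem_fermionSpan s (by omega))
        · simp [hb0 h]
      · have ha' : phi s k (phi s l v) = a • v - phi s l (phi s k v) :=
          eq_sub_of_add_eq (LinearMap.congr_fun ha v)
        have hb' : phi s j (phi s l (phi s k v)) =
            b • phi s k v - phi s l (phi s j (phi s k v)) :=
          eq_sub_of_add_eq (LinearMap.congr_fun hb (phi s k v))
        simp only [Module.End.mul_apply, LinearMap.add_apply, LinearMap.smul_apply, ha', map_sub,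
          map_smul, hb']
        module
    · rintro X Y ⟨X', hX', h⟩ ⟨Y', hY', h'⟩
      exact ⟨X' + Y', add_mem hX' hY', by rw [mul_add, add_mul, h, h']; abel⟩
    · rintro c X ⟨X', hX', h⟩
      exact ⟨c • X', Submodule.smul_mem _ c hX', by
        rw [mul_smul_comm, h, smul_add, smul_mul_assoc]⟩

/-- Makes normal ordering trivial on every term that the triangularity of A allows. -/
theorem vev_phi_mul_phi (s : Species) {j k : ℤ} (h : j + k < 0) : vev (phi s j * phi s k) = 0 := by
  have hv := (IsBosonic.phi_mul_phi s j k).lower (vacuum_mem_energyLE le_rfl)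
  rw [vev, eq_zero_of_mem_energyLE (by omega) hv, Finsupp.coe_zero, Pi.zero_apply]

theorem isBosonic_hatA (s : Species) {A : Matrix ℤ ℤ ℂ} (htri : ∀ j k : ℤ, 0 ≤ j + k → A j k = 0) :
    IsBosonic s 1 (hatA s A) := by
  have hT : ∀ p : ℤ × ℤ, A p.1 p.2 • normalOrder (phi s p.1) (phi s p.2) =
      A p.1 p.2 • (phi s p.1 * phi s p.2) := fun p => by
    by_cases h : 0 ≤ p.1 + p.2
    · rw [htri _ _ h, zero_smul, zero_smul]
    · exact LinearMap.ext fun v => by simp [normalOrder, vev_phi_mul_phi s (not_le.mp h)]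
  unfold hatA
  simp only [hT]
  refine (IsBosonic.opSum (fun p => ?_) fun N => ?_).smul _
  · by_cases h : 0 ≤ p.1 + p.2
    · rw [htri _ _ h, zero_smul]
      exact .zero
    · exact ((IsBosonic.phi_mul_phi s p.1 p.2).smul _).mono (by omega)
  -- If j + k < 0, an index above N forces the other below -N, so outside this square some factor
  -- kills the vector.
  · refine ⟨Finset.Icc (-N) N ×ˢ Finset.Icc (-N) N, fun p hp v hv => ?_⟩
    by_cases h : 0 ≤ p.1 + p.2
    · rw [htri _ _ h, zero_smul, LinearMap.zero_apply]
    · rw [LinearMap.smul_apply, phi_mul_phi_apply_eq_zero s (by omega) ?_ hv, smul_zero]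
      simp only [Finset.mem_product, Finset.mem_Icc] at hp
      omega

theorem isBosonic_currentB (s : Species) {j : ℕ} (hj : 1 ≤ j) : IsBosonic s j (currentB s j) := by
  refine (IsBosonic.opSum (fun k => ?_) fun N => ?_).smul _
  · exact ((IsBosonic.phi_mul_phi s k (-k - j)).smul _).mono (by omega)
  · refine ⟨Finset.Icc (-N) N, fun k hk v hv => ?_⟩
    rw [LinearMap.smul_apply, phi_mul_phi_apply_eq_zero s (by omega) ?_ hv, smul_zero]
    simp only [Finset.mem_Icc] at hk
    omega

theorem isBosonic_opSum_currentB (s : Species) (t : ℕ → ℂ) :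
    IsBosonic s 1 (opSum fun i : ℕ => t i • currentB s (2 * i + 1)) := by
  refine IsBosonic.opSum (fun i => ?_) fun N => ?_
  · exact ((isBosonic_currentB s (by omega)).smul _).mono (by push_cast; omega)
  · refine ⟨Finset.range (N.toNat + 1), fun i hi v hv => ?_⟩
    have h := (isBosonic_currentB s (j := 2 * i + 1) (by omega)).lower hv
    rw [Finset.mem_range] at hi
    rw [LinearMap.smul_apply, eq_zero_of_mem_energyLE (by push_cast; omega) h, smul_zero]

/-! ## Conjugation by exponentials of bosonic operators -/

namespace IsBosonic

variable {s : Species} {B : Module.End ℂ Fock}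

theorem pow_mem (hB : IsBosonic s 1 B) {N : ℤ} {v : Fock} (hv : v ∈ energyLE N) (n : ℕ) :
    (B ^ n) v ∈ energyLE (N - n) := by
  induction n with
  | zero => simpa using hv
  | succ n ih =>
    rw [pow_succ', Module.End.mul_apply]
    have := hB.lower ih
    rwa [show N - ((n + 1 : ℕ) : ℤ) = N - n - 1 by push_cast; ring]

theorem opExp_eq_sum (hB : IsBosonic s 1 B) {N : ℤ} {v : Fock} (hv : v ∈ energyLE N) {K : ℕ}
    (hK : N < K) : opExp B v = ∑ n ∈ Finset.range K, ((n.factorial : ℂ)⁻¹) • (B ^ n) v := by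
  have hF : ∀ (N : ℤ) (K : ℕ), N < K → ∀ n ∉ Finset.range K, ∀ v ∈ energyLE N,
      (((n.factorial : ℂ)⁻¹) • B ^ n) v = 0 := fun N K hK n hn v hv => by
    rw [Finset.mem_range] at hn
    rw [LinearMap.smul_apply, eq_zero_of_mem_energyLE (by omega) (hB.pow_mem hv n), smul_zero]
  rw [opExp, opSum_eq_sum (fun N => ⟨Finset.range (N.toNat + 1), hF N _ (by omega)⟩)
    (hF N K hK) hv, LinearMap.sum_apply]
  rfl

theorem opExp_vacuum (hB : IsBosonic s 1 B) : opExp B vacuum = vacuum := by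
  rw [hB.opExp_eq_sum (vacuum_mem_energyLE le_rfl) (K := 1) (by norm_num)]
  simp

theorem opExp_mem (hB : IsBosonic s 1 B) {N : ℤ} {v : Fock} (hv : v ∈ energyLE N) :
    opExp B v ∈ energyLE N := by
  rw [hB.opExp_eq_sum hv (K := N.toNat + 1) (by omega)]
  exact sum_mem fun n _ => Submodule.smul_mem _ _ (energyLE_mono (by omega) (hB.pow_mem hv n))

/-- The iterated commutators of `B` with a linear combination of neutral fermions. -/
theorem exists_iterated_comm (hB : IsBosonic s 1 B) (N : ℤ) {d : ℤ} {X : Module.End ℂ Fock}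
    (hX : X ∈ fermionSpan s d) : ∃ Z : ℕ → Module.End ℂ Fock, Z 0 = X ∧
      (∀ i : ℕ, Z i ∈ fermionSpan s (d - i)) ∧
      ∀ i, ∀ v ∈ energyLE N, B (Z i v) = Z i (B v) + Z (i + 1) v := by
  choose g hg hgc using fun (d : ℤ) (X : Module.End ℂ Fock) (hX : X ∈ fermionSpan s d) =>
    hB.comm N hX
  let Z : ∀ i : ℕ, {X // X ∈ fermionSpan s (d - i)} := fun i =>
    Nat.rec (motive := fun i => {X // X ∈ fermionSpan s (d - (i : ℕ))}) ⟨X, by simpa using hX⟩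
      (fun i p => ⟨g _ p.1 p.2, by
        have := hg _ p.1 p.2
        rwa [show d - ((i + 1 : ℕ) : ℤ) = d - i - 1 by push_cast; ring]⟩) i
  exact ⟨fun i => (Z i).1, rfl, fun i => (Z i).2, fun i v hv => hgc _ (Z i).1 (Z i).2 v hv⟩

/-- The Leibniz rule Bⁿ X = ∑ C(n,i) (ad B)^i(X) B^{n-i}, with `Z i` in the role of (ad B)^i(X). -/
theorem pow_apply_eq_sum (hB : IsBosonic s 1 B) {N : ℤ} {Z : ℕ → Module.End ℂ Fock}
    (hZ : ∀ i, ∀ v ∈ energyLE N, B (Z i v) = Z i (B v) + Z (i + 1) v) {v : Fock}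
    (hv : v ∈ energyLE N) (n : ℕ) :
    (B ^ n) (Z 0 v) = ∑ p ∈ Finset.HasAntidiagonal.antidiagonal n, n.choose p.1 • Z p.1 ((B ^ p.2) v) := by
  induction n with
  | zero => simp
  | succ n ih =>
    rw [Finset.sum_antidiagonal_choose_succ_nsmul (fun i j => Z i ((B ^ j) v)), pow_succ',
      Module.End.mul_apply, ih, map_sum, ← Finset.sum_add_distrib]
    refine Finset.sum_congr rfl fun p hp => ?_
    rw [map_nsmul, hZ _ _ (energyLE_mono (by omega) (hB.pow_mem hv p.2)), pow_succ',
      Module.End.mul_apply, smul_add, ← Finset.HasAntidiagonal.mem_antidiagonal.1 hp, Nat.choose_symm_add]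

/-- This is e^B X = (e^{ad B} X) e^B, with the series for e^{ad B} X cut off where it no longer
matters on energy at most N. -/
theorem exists_opExp_apply (hB : IsBosonic s 1 B) (N : ℤ) {d : ℤ} {X : Module.End ℂ Fock}
    (hX : X ∈ fermionSpan s d) :
    ∃ Y ∈ fermionSpan s d, ∀ v ∈ energyLE N, opExp B (X v) = Y (opExp B v) := by
  obtain ⟨Z, hZ0, hZd, hZ⟩ := hB.exists_iterated_comm N hX
  -- K exceeds both N and N + d: it truncates e^B on v and on X v, and makes the double series
  -- vanish once i + j ≥ K.
  let K : ℕ := N.toNat + (N + d).toNat + 1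
  refine ⟨∑ i ∈ Finset.range K, ((i.factorial : ℂ)⁻¹) • Z i, sum_mem fun i _ =>
    Submodule.smul_mem _ _ (fermionSpan_mono s (by omega) (hZd i)), fun v hv => ?_⟩
  let a : ℕ → ℕ → Fock := fun i j =>
    ((i.factorial : ℂ)⁻¹ * (j.factorial : ℂ)⁻¹) • Z i ((B ^ j) v)
  have hn : ∀ n, ((n.factorial : ℂ)⁻¹) • (B ^ n) (X v) =
      ∑ k ∈ Finset.range (n + 1), a k (n - k) := fun n => by
    rw [← hZ0, hB.pow_apply_eq_sum hZ hv, Finset.smul_sum,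
      ← Finset.Nat.sum_antidiagonal_eq_sum_range_succ a n]
    refine Finset.sum_congr rfl fun p hp => ?_
    rw [← Finset.HasAntidiagonal.mem_antidiagonal.1 hp, ← Nat.cast_smul_eq_nsmul ℂ, smul_smul]
    congr 1
    rw [Nat.cast_add_choose]
    have := (p.1 + p.2).factorial_ne_zero
    field_simp
  have ha : ∀ i j, K ≤ i + j → a i j = 0 := fun i j hij => by
    have h := apply_mem_energyLE (hZd i) (hB.pow_mem hv j)
    simp only [a]
    rw [eq_zero_of_mem_energyLE (by omega) h, smul_zero]
  rw [hB.opExp_eq_sum (apply_mem_energyLE hX hv) (K := K) (by omega),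
    hB.opExp_eq_sum hv (K := K) (by omega), Finset.sum_congr rfl fun n _ => hn n,
    Finset.sum_range_diag_flip, LinearMap.sum_apply]
  refine Finset.sum_congr rfl fun i hi => ?_
  -- The triangle i + j < K is enlarged to a square; the added terms are zero.
  rw [map_sum, Finset.sum_subset (Finset.range_mono (Nat.sub_le K i)) fun j _ hj => ha i j (by
    rw [Finset.mem_range] at hj; omega)]
  refine Finset.sum_congr rfl fun j _ => ?_
  rw [LinearMap.smul_apply, map_smul, smul_smul]

end IsBosonic

/-! ## Wick's theorem -/

theorem vacuum_apply_vac : vacuum Maya.vac = 1 := Finsupp.single_eq_same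

theorem ket_apply_vac_of_ne {S : Maya} (h : S ≠ Maya.vac) : ket S Maya.vac = 0 := by
  simp [ket, h]

theorem apply_vac_psi {j : ℤ} (hj : 0 ≤ j) (v : Fock) : (psi j v) Maya.vac = 0 := by
  induction v using Finsupp.induction_linear with
  | zero => simp
  | add f g hf hg => rw [map_add, Finsupp.add_apply, hf, hg, add_zero]
  | single S c =>
    have h : (Finsupp.single S c : Fock) = c • ket S := by simp [ket]
    rw [h, map_smul, Finsupp.smul_apply]
    by_cases hS : j ∈ S.carrier
    · simp [psi_ket_of_mem hS]
    · have hne : S.add j ≠ Maya.vac := fun h' => by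
        have := Maya.mem_add j S
        rw [h'] at this
        exact absurd hj (not_le.mpr this)
      simp [psi_ket_of_notMem hS, ket_apply_vac_of_ne hne]

theorem apply_vac_psiDag {j : ℤ} (hj : j < 0) (v : Fock) : (psiDag j v) Maya.vac = 0 := by
  induction v using Finsupp.induction_linear with
  | zero => simp
  | add f g hf hg => rw [map_add, Finsupp.add_apply, hf, hg, add_zero]
  | single S c =>
    have h : (Finsupp.single S c : Fock) = c • ket S := by simp [ket]
    rw [h, map_smul, Finsupp.smul_apply]
    by_cases hS : j ∈ S.carrier
    · have hne : S.del j ≠ Maya.vac := fun h' => by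
        have := Maya.notMem_del j S
        rw [h'] at this
        exact this hj
      simp [psiDag_ket_of_mem hS, ket_apply_vac_of_ne hne]
    · simp [psiDag_ket_of_notMem hS]

/-- An operator anticommuting with all neutral fermions up to scalars does so with their linear
combinations. -/
theorem exists_anticomm {s : Species} {Z : Module.End ℂ Fock}
    (hZ : ∀ k, ∃ c : ℂ, ∀ v, Z (phi s k v) + phi s k (Z v) = c • v) {d : ℤ}
    {Y : Module.End ℂ Fock} (hY : Y ∈ fermionSpan s d) :
    ∃ c : ℂ, ∀ v, Z (Y v) + Y (Z v) = c • v := by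
  refine fermionSpan_induction (p := fun Y => ∃ c : ℂ, ∀ v, Z (Y v) + Y (Z v) = c • v)
    (fun k _ => hZ k) ⟨0, fun v => by simp⟩ ?_ ?_ hY
  · rintro X Y ⟨a, ha⟩ ⟨b, hb⟩
    refine ⟨a + b, fun v => ?_⟩
    rw [add_smul, ← ha, ← hb]
    simp only [LinearMap.add_apply, map_add]
    abel
  · rintro a X ⟨b, hb⟩
    refine ⟨a * b, fun v => ?_⟩
    rw [mul_smul, ← hb]
    simp only [LinearMap.smul_apply, map_smul, smul_add]

/-- A linear combination of neutral fermions acts on the dual vacuum as an operator which kills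
the vacuum and anticommutes with the neutral fermions up to scalars. -/
theorem exists_annihilator {s : Species} {d : ℤ} {Y : Module.End ℂ Fock}
    (hY : Y ∈ fermionSpan s d) : ∃ Z : Module.End ℂ Fock, Z vacuum = 0 ∧
      (∀ v, (Y v) Maya.vac = (Z v) Maya.vac) ∧
      ∀ k, ∃ c : ℂ, ∀ v, Z (phi s k v) + phi s k (Z v) = c • v := by
  refine fermionSpan_induction (p := fun Y => ∃ Z : Module.End ℂ Fock, Z vacuum = 0 ∧
      (∀ v, (Y v) Maya.vac = (Z v) Maya.vac) ∧
      ∀ k, ∃ c : ℂ, ∀ v, Z (phi s k v) + phi s k (Z v) = c • v) (fun j _ => ?_)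
    ⟨0, by simp, fun v => by simp, fun k => ⟨0, fun v => by simp⟩⟩ ?_ ?_ hY
  · obtain ⟨u, ε, h⟩ := exists_phi_eq s
    -- For j < 0, φ_j itself kills |0⟩. For j > 0, ⟨0|φ_j = 0. For j = 0, ⟨0|ψ_0 = 0 leaves only the
    -- ψ†_0 part, which kills |0⟩.
    rcases lt_trichotomy j 0 with hj | rfl | hj
    · refine ⟨phi s j, phi_apply_eq_zero s (by omega) (vacuum_mem_energyLE le_rfl),
        fun v => rfl, fun k => ?_⟩
      obtain ⟨c, hc, -⟩ := exists_phi_anticomm s j k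
      exact ⟨c, fun v => LinearMap.congr_fun hc v⟩
    · refine ⟨(u * ε) • psiDag 0, ?_, fun v => ?_, fun k => ?_⟩
      · rw [LinearMap.smul_apply, vacuum, psiDag_ket_of_notMem (fun h' : (0 : ℤ) < 0 => by omega),
          smul_zero]
      · rw [h]
        simp [apply_vac_psi le_rfl v, mul_assoc]
      · obtain ⟨c, hc⟩ := exists_psiDag_zero_phi_anticomm s k
        refine ⟨u * ε * c, fun v => ?_⟩
        have hv : psiDag 0 (phi s k v) + phi s k (psiDag 0 v) = c • v := LinearMap.congr_fun hc v
        rw [mul_smul _ c, ← hv]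
        simp only [LinearMap.smul_apply, map_smul, smul_add]
    · refine ⟨0, by simp, fun v => ?_, fun k => ⟨0, fun v => by simp⟩⟩
      rw [h]
      simp [apply_vac_psi hj.le v, apply_vac_psiDag (neg_lt_zero.mpr hj) v]
  · rintro X Y ⟨Z, h1, h2, h3⟩ ⟨W, h4, h5, h6⟩
    refine ⟨Z + W, by simp [h1, h4], fun v => by simp [h2, h5], fun k => ?_⟩
    obtain ⟨a, ha⟩ := h3 k
    obtain ⟨b, hb⟩ := h6 k
    refine ⟨a + b, fun v => ?_⟩
    rw [add_smul, ← ha, ← hb]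
    simp only [LinearMap.add_apply, map_add]
    abel
  · rintro a X ⟨Z, h1, h2, h3⟩
    refine ⟨a • Z, by simp [h1], fun v => by simp [h2], fun k => ?_⟩
    obtain ⟨b, hb⟩ := h3 k
    refine ⟨a * b, fun v => ?_⟩
    rw [mul_smul, ← hb]
    simp only [LinearMap.smul_apply, map_smul, smul_add]

/-- Moving an annihilator through a product of operators with scalar anticommutators. -/
theorem annihilator_prod_apply {V : Type*} [AddCommGroup V] [Module ℂ V] {Z : Module.End ℂ V}
    {w : V} (hw : Z w = 0) : ∀ {n : ℕ} (Y : Fin (n + 1) → Module.End ℂ V) (c : Fin (n + 1) → ℂ),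
      (∀ i v, Z (Y i v) + Y i (Z v) = c i • v) →
      Z ((List.ofFn Y).prod w) = ∑ j : Fin (n + 1),
        ((-1) ^ (j : ℕ) * c j) • (List.ofFn fun k => Y (j.succAbove k)).prod w
  | 0, Y, c, h => by
    have := h 0 w
    rw [hw, map_zero, add_zero] at this
    simp [this]
  | n + 1, Y, c, h => by
    have IH := annihilator_prod_apply hw (fun k => Y k.succ) (fun k => c k.succ) fun i v => h _ v
    rw [List.ofFn_succ, List.prod_cons, Module.End.mul_apply, eq_sub_of_add_eq (h 0 _), IH,
      map_sum, sub_eq_add_neg, ← Finset.sum_neg_distrib]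
    conv_rhs => rw [Fin.sum_univ_succ]
    congr 1
    · simp
    · refine Finset.sum_congr rfl fun j _ => ?_
      rw [List.ofFn_succ, List.prod_cons, Module.End.mul_apply, map_smul, Fin.succ_succAbove_zero,
        Fin.val_succ, pow_succ]
      simp only [Fin.succ_succAbove_succ]
      module

/-- A locally well-defined group element: it fixes the vacuum and carries neutral fermions to
linear combinations of them on vectors of bounded energy. -/
structure IsGroupLike (s : Species) (G : Module.End ℂ Fock) : Prop where
  vacuum : G vacuum = vacuum
  conj : ∀ (N : ℤ) {d : ℤ} {X : Module.End ℂ Fock}, X ∈ fermionSpan s d →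
    ∃ Y ∈ fermionSpan s d, ∀ v ∈ energyLE N, G (X v) = Y (G v)

theorem IsBosonic.isGroupLike_opExp {s : Species} {B : Module.End ℂ Fock}
    (hB : IsBosonic s 1 B) : IsGroupLike s (opExp B) :=
  ⟨hB.opExp_vacuum, fun N _ _ hX => hB.exists_opExp_apply N hX⟩

theorem IsGroupLike.opExp_mul {s : Species} {B G : Module.End ℂ Fock} (hG : IsGroupLike s G)
    (hB : IsBosonic s 1 B) : IsGroupLike s (G * opExp B) := by
  refine ⟨by rw [Module.End.mul_apply, hB.opExp_vacuum, hG.vacuum], fun N d X hX => ?_⟩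
  obtain ⟨Y, hY, hXY⟩ := hB.exists_opExp_apply N hX
  obtain ⟨W, hW, hYW⟩ := hG.conj N hY
  refine ⟨W, hW, fun v hv => ?_⟩
  rw [Module.End.mul_apply, Module.End.mul_apply, hXY v hv, hYW _ (hB.opExp_mem hv)]

/-! ### Matrix elements of group-like operators on fermion states. -/

theorem state_succ (s : Species) {n : ℕ} (y : Fin (n + 1) → ℕ) :
    state s y = phi s (y 0) (state s fun k => y k.succ) := by
  simp only [state, List.ofFn_succ, List.prod_cons, Module.End.mul_apply]

theorem state_mem_energyLE (s : Species) : ∀ {n : ℕ} (y : Fin n → ℕ),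
    state s y ∈ energyLE (∑ i, y i : ℕ)
  | 0, y => by simpa [state] using vacuum_mem_energyLE le_rfl
  | n + 1, y => by
    have := phi_mem_energyLE s (y 0) (state_mem_energyLE s fun k => y k.succ)
    rw [state_succ, Fin.sum_univ_succ]
    exact energyLE_mono (by push_cast; omega) this

theorem apply_state_eq {s : Species} {G : Module.End ℂ Fock} (hvac : G vacuum = vacuum) {N : ℕ}
    {Y : ℕ → Module.End ℂ Fock} (hY : ∀ l : ℕ, ∀ v ∈ energyLE N, G (phi s l v) = Y l (G v)) :
    ∀ {n : ℕ} (y : Fin n → ℕ), ∑ i, y i ≤ N → G (state s y) = (List.ofFn fun k => Y (y k)).prod vacuum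
  | 0, y, _ => by simpa [state] using hvac
  | n + 1, y, h => by
    rw [Fin.sum_univ_succ] at h
    rw [state_succ, hY _ _ (energyLE_mono (by exact_mod_cast (Nat.le_add_left _ _).trans h)
      (state_mem_energyLE s fun k => y k.succ)),
      apply_state_eq hvac hY _ ((Nat.le_add_left _ _).trans h), List.ofFn_succ, List.prod_cons,
      Module.End.mul_apply]

theorem wick_expansion {s : Species} {G : Module.End ℂ Fock} (hG : IsGroupLike s G) {n : ℕ}
    (y : Fin (n + 2) → ℕ) :
    (G (state s y)) Maya.vac = ∑ j : Fin (n + 1), (-1) ^ (j : ℕ) *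
      (G (state s ![y 0, y j.succ])) Maya.vac *
        (G (state s fun k => y (j.succAbove k).succ)) Maya.vac := by
  -- Indices are nonnegative, so N also bounds the energies of the pairs and of the shortened
  -- states. One choice of conjugated fermions `Y` thus serves all factors.
  set N := ∑ i, y i
  choose Y hYmem hY using fun l : ℕ => hG.conj N (phi_mem_fermionSpan s (le_refl (l : ℤ)))
  obtain ⟨Z, hZvac, hZ, hZanti⟩ := exists_annihilator (hYmem (y 0))
  choose c hc using fun l : ℕ => exists_anticomm hZanti (hYmem l)
  have hstate : ∀ {r : ℕ} (z : Fin r → ℕ), ∑ i, z i ≤ N →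
      G (state s z) = (List.ofFn fun k => Y (z k)).prod vacuum := fun z hz =>
    apply_state_eq hG.vacuum hY z hz
  have hN0 : N = y 0 + ∑ i, y (Fin.succ i) := Fin.sum_univ_succ _
  have hNj : ∀ j : Fin (n + 1), N = y 0 + (y j.succ + ∑ k, y (j.succAbove k).succ) := fun j => by
    rw [hN0, Fin.sum_univ_succAbove _ j]
  -- The scalar anticommutators are exactly the two-point functions.
  have hpair : ∀ j : Fin (n + 1), (G (state s ![y 0, y j.succ])) Maya.vac = c (y j.succ) := by
    intro j
    rw [hstate _ (by rw [hNj j, Fin.sum_univ_two]; simp)]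
    have h1 := hc (y j.succ) vacuum
    rw [hZvac, map_zero, add_zero] at h1
    simp [List.ofFn_succ, hZ, h1, vacuum_apply_vac]
  rw [hstate y le_rfl, List.ofFn_succ, List.prod_cons, Module.End.mul_apply, hZ,
    annihilator_prod_apply hZvac (fun k => Y (y k.succ)) (fun k => c (y k.succ))
      (fun i v => hc _ v), Finsupp.finsetSum_apply]
  refine Finset.sum_congr rfl fun j _ => ?_
  rw [Finsupp.smul_apply, hpair, hstate _ (by rw [hNj j]; omega), smul_eq_mul]

/-- Distinct nonnegative indices never sum to 0, so these fermions strictly anticommute even if a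
part is 0. -/
theorem apply_state_comp_perm (s : Species) (G : Module.End ℂ Fock) {n : ℕ} (y : Fin n → ℕ)
    (hy : Function.Injective y) (σ : Equiv.Perm (Fin n)) :
    (G (state s fun k => y (σ k))) Maya.vac =
      ((Equiv.Perm.sign σ : ℤ) : ℂ) * (G (state s y)) Maya.vac := by
  have h := prod_ofFn_comp_perm σ (fun k => phi s (y k)) fun i j hij =>
    phi_anticomm_of_ne s fun h => hij (hy (by omega))
  rw [state, h, state]
  rcases Int.units_eq_one_or (Equiv.Perm.sign σ) with h' | h' <;> simp [h']

theorem apply_state_eq_pfaffian {s : Species} {G : Module.End ℂ Fock} (hG : IsGroupLike s G)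
    {m : ℕ} (y : Fin (2 * m) → ℕ) (hy : Function.Injective y) :
    (G (state s y)) Maya.vac =
      pfaffian (Matrix.of fun i j => (G (state s ![y i, y j])) Maya.vac) :=
  eq_pfaffian_of_expansion (fun _ y => (G (state s y)) Maya.vac)
    (fun y => by simp [state, hG.vacuum, vacuum_apply_vac])
    (fun _ y hy σ => apply_state_comp_perm s G y hy σ) (fun _ y => wick_expansion hG y) m y hy

end BKP

/-! ### The Pfaffian formula. -/

theorem proposition4p2 (s : BKP.Species) (A : Matrix ℤ ℤ ℂ)
    (hskew : ∀ j k : ℤ, A k j = -A j k)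
    (htri : ∀ j k : ℤ, 0 ≤ j + k → A j k = 0)
    {m n : ℕ} (α : Fin (2 * m) → ℕ) (hα : StrictAnti α) (x : Fin n → ℂ) :
    BKP.schurQ s A α (BKP.powerSumB x) =
      BKP.pfaffian (BKP.twoPartMatrix s A α (BKP.powerSumB x)) := by
  open BKP in
  set t := powerSumB x
  have hG : IsGroupLike s (gammaB s (fun i => 2 * t i) * hatH s A) :=
    (isBosonic_opSum_currentB s _).isGroupLike_opExp.opExp_mul (isBosonic_hatA s htri)
  have hpow : ∀ r : ℕ, (((2 : ℝ) ^ (-(((2 * r : ℕ) : ℝ) / 2)) : ℝ) : ℂ) = (1 / 2 : ℂ) ^ r := by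
    intro r
    rw [show -(((2 * r : ℕ) : ℝ) / 2) = -(r : ℝ) by push_cast; ring,
      Real.rpow_neg (by norm_num), Real.rpow_natCast]
    push_cast
    simp
  have hpair : ∀ i j : Fin (2 * m), schurQ s A ![α i, α j] t = (1 / 2 : ℂ) *
      ((gammaB s (fun i => 2 * t i) * hatH s A) (state s ![α i, α j])) Maya.vac := fun i j => by
    -- A pair is the case of 2·1 parts, so its prefactor is exactly 1/2.
    exact congrArg (· * _) ((hpow 1).trans (pow_one _))
  have hanti : ∀ i j : Fin (2 * m), i ≠ j →
      ((gammaB s (fun i => 2 * t i) * hatH s A) (state s ![α j, α i])) Maya.vac =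
      -((gammaB s (fun i => 2 * t i) * hatH s A) (state s ![α i, α j])) Maya.vac := fun i j hij => by
    have h := phi_anticomm_of_ne s (j := α i) (k := α j)
      fun h => hij (hα.injective (by omega))
    simp [state, List.ofFn_succ, ← Module.End.mul_apply, h]
  rw [schurQ, hpow, kappa, ← Module.End.mul_apply,
    apply_state_eq_pfaffian hG α hα.injective, ← pfaffian_smul]
  refine pfaffian_congr fun i j hij => ?_
  simp only [twoPartMatrix, Matrix.smul_apply, Matrix.of_apply, smul_eq_mul]
  rcases lt_or_gt_of_ne hij with h | h
  · rw [if_pos h, hpair]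
  · rw [if_neg h.not_gt, if_pos h, hpair, hanti i j hij]
    ring

end
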